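/- A graph on a set $X$ is an irreflexive symmetric relation on $X$. For graphs $G$, $H$ on Polish spaces $X$, $Y$, write $G \preceq_B H$ if there is a Borel homomorphism from $G$ to $H$, i.e. a Borel function $h \colon X \to Y$ such that $x \mathrel{G} y$ implies $h(x) \mathrel{H} h(y)$ for all $x,y \in X$. The Louveau jump of $G$ is the graph $G^{L}$ on $X^{\omega}$ defined by $$x \mathrel{G^{L}} y \iff \exists n\, \forall i \ge n\ \bigl(x(i) \mathrel{G} y(i)\bigr).$$ A graph is called analytic (Borel) if its edge relation is an analytic (Borel) subset of $X \times X$. **Theorem.** (1) Let $G$ be an analytic graph on a Polish space which has at least one edge and is bipartite or, more generally, triangle-free. Then $G \preceq_B G^{L}$, but $G^{L} \not\preceq_B G$, i.e. there is no Borel homomorphism from $G^{L}$ to $G$. (2) Hence the class of bipartite Borel graphs on Polish spaces is unbounded under $\preceq_B$: for every bipartite Borel graph $G$ on a Polish space there is a bipartite Borel graph $H$ on a Polish space with $G \preceq_B H$ and $H \not\preceq_B G$. In particular no bipartite Borel graph $H_0$ satisfies $G \preceq_B H_0$ for all bipartite Borel graphs $G$. -/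

import Mathlib

open MeasureTheory

universe u

/-- The edge relation of `G`, as a subset of `X × X`. -/
def edgeRel {X : Type*} (G : SimpleGraph X) : Set (X × X) :=
  {p | G.Adj p.1 p.2}

/-- A graph with a Borel edge relation (on a Polish space carrying its Borel sets). -/
def IsBorelGraph {X : Type*} [MeasurableSpace X] (G : SimpleGraph X) : Prop :=
  MeasurableSet (edgeRel G)

/-- A graph with an analytic edge relation. -/
def IsAnalyticGraph {X : Type*} [TopologicalSpace X] (G : SimpleGraph X) : Prop :=
  AnalyticSet (edgeRel G)

/-- `G ≼_B H`: there is a Borel graph homomorphism from `G` to `H`. -/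
def BorelHomLE {X Y : Type*} [MeasurableSpace X] [MeasurableSpace Y]
    (G : SimpleGraph X) (H : SimpleGraph Y) : Prop :=
  ∃ h : X → Y, Measurable h ∧ ∀ x y : X, G.Adj x y → H.Adj (h x) (h y)

/-- The Louveau jump of `G`: sequences of vertices are adjacent if they are coordinatewise
`G`-adjacent from some point on. -/
def louveauJump {X : Type*} (G : SimpleGraph X) : SimpleGraph (ℕ → X) where
  Adj x y := ∃ n, ∀ i, n ≤ i → G.Adj (x i) (y i)
  symm := ⟨fun _ _ ⟨n, hn⟩ => ⟨n, fun i hi => (hn i hi).symm⟩⟩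
  loopless := ⟨fun _ ⟨n, hn⟩ => G.irrefl (hn n le_rfl)⟩

/-!
That `G` maps to its Louveau jump is witnessed by constant sequences. For the converse, suppose
that `G` is analytic, triangle-free and has an edge, and that `h` is a Borel homomorphism from the
jump of `G` to `G`. Iterating `h` along countable well-founded trees produces Borel homomorphisms
for adjacency modulo all filters obtained from `atTop` on `ℕ` and principal ultrafilters by Fubini
sums (`HasBorelLimits.bind`). Every Borel subset of the Cantor space is a pointwise limit of clopen
sets along such a filter (`IsClopenLimit.of_measurableSet`), so `G` encodes Borel sets of
arbitrarily high complexity. The encoding maps themselves have growing Borel complexity; what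
bounds the complexity is that they become continuous after a generic translation.

In detail, fix an edge of `G` and a Borel set `A`. Composing the limit operation attached to `A`
with the two endpoints gives a Borel map `H` from arrays of bits to vertices such that arrays
differing almost everywhere go to adjacent vertices, while arrays agreeing almost everywhere go to
vertices with a common neighbour (the image of the negated array). A fusion argument, phrased as a
Baire category argument (`exists_forall_rowFlip_mem`), yields an array `x` all of whose
perturbations `rowFlip n c x` lie in a comeagre set on which `H` is continuous. Letting `c` depend
continuously on `z` gives a continuous `f` with `f z = (H x, H (rowFlip n (c z) x))`, an edge if
`z ∈ A` and a pair with a common neighbour if `z ∉ A`. By triangle-freeness these two kinds of pairs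
form disjoint analytic sets, so one Borel set `C`, not depending on `A`, separates them
(`exists_measurableSet_separating`). Hence every Borel `A` is a continuous preimage of the fixed set
`C`, which a diagonal argument excludes (`exists_measurableSet_forall_ne_preimage`).

The jump of a bipartite graph is bipartite, by taking limits of colours along an ultrafilter
(`isBipartite_louveauJump`), and the jump of a Borel graph is Borel; so a bipartite Borel graph with
an edge lies strictly below its jump, which is again such a graph.
-/

open Filter Set Topology

/-! ### Limit operations on vertices along filters -/

/-- `G` has *Borel limits* along the filter `F` if some Borel map sends families of vertices to
vertices so that families adjacent `F`-almost everywhere go to adjacent vertices. -/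
def HasBorelLimits {X ι : Type*} [MeasurableSpace X] (G : SimpleGraph X) (F : Filter ι) : Prop :=
  ∃ Φ : (ι → X) → X, Measurable Φ ∧
    ∀ v w : ι → X, (∀ᶠ i in F, G.Adj (v i) (w i)) → G.Adj (Φ v) (Φ w)

theorem hasBorelLimits_pure {X ι : Type*} [MeasurableSpace X] (G : SimpleGraph X) (i : ι) :
    HasBorelLimits G (pure i : Filter ι) :=
  ⟨fun v => v i, measurable_pi_apply i, fun _ _ h => h⟩

/-- Composition of limit operations, as in the iterated Fubini sums of the Fréchet filter. -/
theorem HasBorelLimits.bind {X ι κ : Type*} [MeasurableSpace X] {G : SimpleGraph X}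
    {F : Filter ι} {K : ι → Filter κ} (hF : HasBorelLimits G F)
    (hK : ∀ i, HasBorelLimits G (K i)) : HasBorelLimits G (F.bind K) := by
  obtain ⟨Φ, hΦ, hΦG⟩ := hF
  choose Ψ hΨ hΨG using hK
  refine ⟨fun v => Φ fun i => Ψ i v, hΦ.comp (measurable_pi_lambda _ hΨ), fun v w h => ?_⟩
  exact hΦG _ _ ((eventually_bind.1 h).mono fun i hi => hΨG i _ _ hi)

/-- Adjacency in the Louveau jump is adjacency along `atTop`. -/
theorem hasBorelLimits_atTop {X : Type*} [MeasurableSpace X] {G : SimpleGraph X}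
    (h : BorelHomLE (louveauJump G) G) : HasBorelLimits G (atTop : Filter ℕ) := by
  obtain ⟨h, hm, hG⟩ := h
  exact ⟨h, hm, fun v w hvw => hG v w (eventually_atTop.1 hvw)⟩

/-! ### Borel sets as limits of clopen sets -/

/-- `A` is a pointwise limit of clopen sets along some filter `F` along which `G` has Borel limits:
every `z` is classified correctly by `F`-almost every clopen set. -/
def IsClopenLimit {X Z : Type*} [MeasurableSpace X] [TopologicalSpace Z] (G : SimpleGraph X)
    (A : Set Z) : Prop :=
  ∃ F : Filter (TopologicalSpace.Clopens Z), HasBorelLimits G F ∧ ∀ z, ∀ᶠ s in F, z ∈ s ↔ z ∈ A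

namespace IsClopenLimit

variable {X Z : Type*} [MeasurableSpace X] [TopologicalSpace Z] {G : SimpleGraph X}

theorem of_isClopen {A : Set Z} (hA : IsClopen A) : IsClopenLimit G A :=
  ⟨pure ⟨A, hA⟩, hasBorelLimits_pure G _, fun _ => Iff.rfl⟩

theorem compl {A : Set Z} (hA : IsClopenLimit G A) : IsClopenLimit G Aᶜ := by
  obtain ⟨F, hF, hFA⟩ := hA
  refine ⟨F.bind fun s => pure sᶜ, hF.bind fun s => hasBorelLimits_pure G _, fun z => ?_⟩
  exact eventually_bind.2 ((hFA z).mono fun s hs => eventually_pure.2 (not_congr hs))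

theorem union {A B : Set Z} (hA : IsClopenLimit G A) (hB : IsClopenLimit G B) :
    IsClopenLimit G (A ∪ B) := by
  obtain ⟨F, hF, hFA⟩ := hA
  obtain ⟨K, hK, hKB⟩ := hB
  refine ⟨F.bind fun s => K.bind fun t => pure (s ⊔ t),
    hF.bind fun s => hK.bind fun t => hasBorelLimits_pure G _, fun z => ?_⟩
  refine eventually_bind.2 ((hFA z).mono fun s hs => ?_)
  refine eventually_bind.2 ((hKB z).mono fun t ht => ?_)
  exact eventually_pure.2 (or_congr hs ht)

theorem of_eventually (hG : HasBorelLimits G (atTop : Filter ℕ)) {A : ℕ → Set Z} {B : Set Z}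
    (hA : ∀ n, IsClopenLimit G (A n)) (hB : ∀ z, ∀ᶠ n in atTop, z ∈ A n ↔ z ∈ B) :
    IsClopenLimit G B := by
  choose F hF hFA using hA
  refine ⟨atTop.bind F, hG.bind hF, fun z => ?_⟩
  exact eventually_bind.2 ((hB z).mono fun n hn => (hFA n z).mono fun s hs => hs.trans hn)

theorem iUnion (hG : HasBorelLimits G (atTop : Filter ℕ)) {A : ℕ → Set Z}
    (hA : ∀ n, IsClopenLimit G (A n)) : IsClopenLimit G (⋃ n, A n) := by
  -- The finite unions converge pointwise to the full union.
  have hacc : ∀ n, IsClopenLimit G (accumulate A n) := by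
    intro n
    induction n with
    | zero => simpa using hA 0
    | succ n ih => rw [accumulate_succ]; exact ih.union (hA _)
  refine of_eventually hG hacc fun z => ?_
  by_cases hz : z ∈ ⋃ n, A n
  · obtain ⟨n, hn⟩ := mem_iUnion.1 hz
    filter_upwards [eventually_ge_atTop n] with k hk
    exact iff_of_true (mem_accumulate.2 ⟨n, hk, hn⟩) hz
  · refine Eventually.of_forall fun k => iff_of_false (fun h => hz ?_) hz
    obtain ⟨n, -, hn⟩ := mem_accumulate.1 h
    exact mem_iUnion.2 ⟨n, hn⟩

/-- If `G` has Borel limits along sequences, the class of limits of clopen sets is a σ-algebra, so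
it exhausts the Borel sets of a zero-dimensional space. -/
theorem of_measurableSet [CompactSpace Z] [T2Space Z] [TotallyDisconnectedSpace Z]
    [SecondCountableTopology Z] [MeasurableSpace Z] [BorelSpace Z]
    (hG : HasBorelLimits G (atTop : Filter ℕ)) {A : Set Z} (hA : MeasurableSet A) :
    IsClopenLimit G A := by
  have hgen : ‹MeasurableSpace Z› = MeasurableSpace.generateFrom {s : Set Z | IsClopen s} :=
    (BorelSpace.measurable_eq (α := Z)).trans
      isTopologicalBasis_isClopen.borel_eq_generateFrom
  rw [hgen] at hA
  induction A, hA using MeasurableSpace.generateFrom_induction with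
  | hC t ht => exact of_isClopen ht
  | empty => exact of_isClopen isClopen_empty
  | compl t _ ih => exact ih.compl
  | iUnion s _ ih => exact iUnion hG ih

end IsClopenLimit

/-! ### Generic continuity of Borel maps along compact families of flips -/

/-- `rowFlip n c x` is the array `x` with, for each `i` such that `c i`, the entries of row `i`
negated from position `n i` on. -/
def rowFlip (n : ℕ → ℕ) (c : ℕ → Bool) (x : ℕ × ℕ → Bool) : ℕ × ℕ → Bool :=
  fun p => xor (x p) (c p.1 && decide (n p.1 ≤ p.2))

theorem continuous_rowFlip {Z : Type*} [TopologicalSpace Z] {n : Z → ℕ → ℕ} {c : Z → ℕ → Bool}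
    {x : Z → ℕ × ℕ → Bool} (hn : Continuous n) (hc : Continuous c) (hx : Continuous x) :
    Continuous fun z => rowFlip (n z) (c z) (x z) := by
  refine continuous_pi fun p => ?_
  have key : Continuous fun q : ℕ × Bool × Bool => xor q.2.2 (q.2.1 && decide (q.1 ≤ p.2)) :=
    continuous_of_discreteTopology
  exact key.comp (((continuous_apply p.1).comp hn).prodMk
    (((continuous_apply p.1).comp hc).prodMk ((continuous_apply p).comp hx)))

theorem rowFlip_rowFlip (n : ℕ → ℕ) (c : ℕ → Bool) (x : ℕ × ℕ → Bool) :
    rowFlip n c (rowFlip n c x) = x := by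
  funext p
  simp [rowFlip]

theorem dense_preimage_rowFlip (n : ℕ → ℕ) (c : ℕ → Bool) {U : Set (ℕ × ℕ → Bool)}
    (hU : Dense U) : Dense (rowFlip n c ⁻¹' U) := by
  have hcont : Continuous (rowFlip n c) :=
    continuous_rowFlip continuous_const continuous_const continuous_id
  let e : (ℕ × ℕ → Bool) ≃ₜ (ℕ × ℕ → Bool) :=
    { toFun := rowFlip n c, invFun := rowFlip n c, left_inv := rowFlip_rowFlip n c,
      right_inv := rowFlip_rowFlip n c, continuous_toFun := hcont, continuous_invFun := hcont }
  exact hU.preimage e.isOpenMap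

/-- Openness is preserved by the universal quantifier because the space of flip patterns `c` is
compact. -/
theorem isOpen_setOf_forall_rowFlip_mem {U : Set (ℕ × ℕ → Bool)} (hU : IsOpen U) :
    IsOpen {q : (ℕ × ℕ → Bool) × (ℕ → ℕ) | ∀ c, rowFlip q.2 c q.1 ∈ U} := by
  have hcl : IsClosed {r : ((ℕ × ℕ → Bool) × (ℕ → ℕ)) × (ℕ → Bool) | rowFlip r.1.2 r.2 r.1.1 ∉ U} :=
    hU.isClosed_compl.preimage (continuous_rowFlip (continuous_snd.comp continuous_fst)
      continuous_snd (continuous_fst.comp continuous_fst))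
  have := (isClosedMap_fst_of_compactSpace _ hcl).isOpen_compl
  convert this using 1
  ext q
  simp

/-- Only finitely many rows have a starting position `n i` decided by a basic open condition. The
others can start arbitrarily late, so only finitely many flips matter inside a finite window, and
all of these can be steered into `U` simultaneously. -/
theorem dense_setOf_forall_rowFlip_mem {U : Set (ℕ × ℕ → Bool)} (hU : IsOpen U) (hd : Dense U) :
    Dense {q : (ℕ × ℕ → Bool) × (ℕ → ℕ) | ∀ c, rowFlip q.2 c q.1 ∈ U} := by
  rw [dense_iff_inter_open]
  rintro O hO ⟨⟨x₀, n₀⟩, hq⟩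
  obtain ⟨O₁, O₂, hO₁, hO₂, hx₀, hn₀, hsub⟩ := isOpen_prod_iff.1 hO x₀ n₀ hq
  obtain ⟨I, u, hu, hIu⟩ := isOpen_pi_iff.1 hO₂ n₀ hn₀
  obtain ⟨m, hm⟩ : ∃ m, ∀ i ∈ I, i < m :=
    ⟨I.sup id + 1, fun i hi => Nat.lt_succ_of_le (Finset.le_sup (f := id) hi)⟩
  -- A flip pattern on the first `m` rows, extended by no flips.
  let ext (c : Fin m → Bool) : ℕ → Bool := fun i => if h : i < m then c ⟨i, h⟩ else false
  have hV : Dense (⋂ c : Fin m → Bool, rowFlip n₀ (ext c) ⁻¹' U) :=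
    dense_iInter_of_isOpen
      (fun c => hU.preimage (continuous_rowFlip continuous_const continuous_const continuous_id))
      fun c => dense_preimage_rowFlip _ _ hd
  -- Finitely many flip patterns on the first `m` rows: one array handles all of them.
  obtain ⟨x, hxO, hxV⟩ := hV.inter_open_nonempty O₁ hO₁ ⟨x₀, hx₀⟩
  have hxV' : ∀ c : Fin m → Bool, rowFlip n₀ (ext c) x ∈ U := fun c => mem_iInter.1 hxV c
  choose J w hw hJ using fun c => isOpen_pi_iff.1 hU _ (hxV' c)
  -- Rows from `m` on are started at `M`, beyond the window that keeps the flipped arrays in `U`.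
  obtain ⟨M, hM⟩ : ∃ M, ∀ c, ∀ p ∈ J c, p.2 < M := by
    refine ⟨(Finset.univ.biUnion J).sup Prod.snd + 1, fun c p hp => Nat.lt_succ_of_le ?_⟩
    exact Finset.le_sup (f := Prod.snd) (Finset.mem_biUnion.2 ⟨c, Finset.mem_univ _, hp⟩)
  refine ⟨(x, fun i => if i < m then n₀ i else M), hsub ⟨hxO, hIu fun i hi => ?_⟩, fun c => ?_⟩
  · simpa [hm i hi] using (hu i hi).2
  · refine hJ (fun i => c i) fun p hp => ?_
    have hpM := hM _ p hp
    have : rowFlip (fun i => if i < m then n₀ i else M) c x p =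
        rowFlip n₀ (ext fun i => c i) x p := by
      by_cases h : p.1 < m <;> simp [rowFlip, ext, h, hpM.not_ge]
    simpa only [this] using (hw _ p hp).2

/-- A comeagre set contains a whole compact family of flips of a single array. Here the starting
positions `n` are chosen generically together with the array; for prescribed `n` this could
fail. -/
theorem exists_forall_rowFlip_mem {D : Set (ℕ × ℕ → Bool)} (hD : D ∈ residual _) :
    ∃ x n, ∀ c, rowFlip n c x ∈ D := by
  obtain ⟨S, hSo, hSd, hSc, hSD⟩ := mem_residual_iff.1 hD
  have := hSc.to_subtype
  have hdense : Dense (⋂ U : S, {q : (ℕ × ℕ → Bool) × (ℕ → ℕ) | ∀ c, rowFlip q.2 c q.1 ∈ U.1}) :=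
    dense_iInter_of_isOpen (fun U => isOpen_setOf_forall_rowFlip_mem (hSo _ U.2))
      fun U => dense_setOf_forall_rowFlip_mem (hSo _ U.2) (hSd _ U.2)
  obtain ⟨q, hq⟩ := hdense.nonempty
  exact ⟨q.1, q.2, fun c => hSD fun U hU => mem_iInter.1 hq ⟨U, hU⟩ c⟩

/-- Every Borel map is continuous on a whole family of flips of some array. -/
theorem exists_continuous_comp_rowFlip {X : Type*} [TopologicalSpace X]
    [SecondCountableTopology X] [MeasurableSpace X] [BorelSpace X]
    {H : (ℕ × ℕ → Bool) → X} (hH : Measurable H) :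
    ∃ x n, Continuous fun c => H (rowFlip n c x) := by
  have hB := TopologicalSpace.isBasis_countableBasis X
  have hBc := TopologicalSpace.countable_countableBasis X
  have hex : ∀ b : TopologicalSpace.countableBasis X,
      ∃ u : Set (ℕ × ℕ → Bool), IsOpen u ∧ H ⁻¹' b.1 =ᶠ[residual _] u := fun b =>
    (hH (TopologicalSpace.isOpen_of_mem_countableBasis b.2).measurableSet).residualEq_isOpen
  -- `H` is continuous on the comeagre set where each `H ⁻¹' b` agrees with the open set `u b`.
  choose u hu hub using hex
  have := hBc.to_subtype
  obtain ⟨x, n, hD⟩ := exists_forall_rowFlip_mem (eventually_countable_forall.2 hub)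
  refine ⟨x, n, hB.continuous_iff.2 fun b hb => ?_⟩
  have : (fun c => H (rowFlip n c x)) ⁻¹' b = (fun c => rowFlip n c x) ⁻¹' u ⟨b, hb⟩ := by
    ext c
    exact iff_of_eq (hD c ⟨b, hb⟩)
  rw [this]
  exact (hu _).preimage (continuous_rowFlip continuous_const continuous_id continuous_const)

/-! ### Diagonalisation and separation -/

/-- Diagonalisation over the continuous maps from the Cantor space to `W`. These form a Polish
space, hence are parametrised in a Borel way by the Cantor space itself. -/
theorem exists_measurableSet_forall_ne_preimage {W : Type*} [TopologicalSpace W] [PolishSpace W]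
    [MeasurableSpace W] [BorelSpace W] [Nonempty W] {C : Set W} (hC : MeasurableSet C) :
    ∃ A : Set (ℕ → Bool), MeasurableSet A ∧ ∀ f : (ℕ → Bool) → W, Continuous f → f ⁻¹' C ≠ A := by
  let := TopologicalSpace.upgradeIsCompletelyMetrizable W
  have : Nonempty C(ℕ → Bool, W) := ⟨.const _ (Classical.arbitrary W)⟩
  obtain ⟨s, hs, hsurj⟩ := PolishSpace.exists_nat_nat_continuous_surjective C(ℕ → Bool, W)
  have hunc : ¬ Countable (ℕ → ℕ) := by
    rw [← Cardinal.mk_le_aleph0_iff]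
    simp [Cardinal.aleph0_lt_continuum]
  let φ : (ℕ → Bool) ≃ᵐ (ℕ → ℕ) := (PolishSpace.measurableEquivNatBoolOfNotCountable hunc).symm
  have heval : Measurable fun q : (ℕ → ℕ) × (ℕ → Bool) => s q.1 q.2 := by
    have : Continuous fun q : (ℕ → ℕ) × (ℕ → Bool) => s q.1 q.2 := by fun_prop
    exact this.measurable
  refine ⟨{z | s (φ z) z ∉ C}, (heval.comp (φ.measurable.prodMk measurable_id)) hC.compl, ?_⟩
  intro f hf h
  obtain ⟨a, ha⟩ := hsurj ⟨f, hf⟩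
  have hz := Set.ext_iff.1 h (φ.symm a)
  simp [ha] at hz

/-- In a triangle-free graph the endpoints of an edge have no common neighbour, so the edges and
the pairs with a common neighbour form disjoint analytic sets, and Lusin's theorem applies. -/
theorem exists_measurableSet_separating {X : Type*} [TopologicalSpace X] [PolishSpace X]
    [MeasurableSpace X] [BorelSpace X] {G : SimpleGraph X} (hG : IsAnalyticGraph G)
    (htri : G.CliqueFree 3) :
    ∃ C : Set (X × X), MeasurableSet C ∧ (∀ u v, G.Adj u v → (u, v) ∈ C) ∧
      ∀ u v w, G.Adj u w → G.Adj w v → (u, v) ∉ C := by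
  -- Paths `(u, w, v)` of length two, written as a countable intersection.
  let P : Bool → Set (X × X × X) := fun b =>
    bif b then (fun q => (q.1, q.2.1)) ⁻¹' edgeRel G else (fun q => (q.2.1, q.2.2)) ⁻¹' edgeRel G
  have hP : AnalyticSet (⋂ b, P b) := by
    refine AnalyticSet.iInter fun b => ?_
    cases b
    · exact AnalyticSet.preimage hG (by fun_prop : Continuous fun q : X × X × X => (q.2.1, q.2.2))
    · exact AnalyticSet.preimage hG (by fun_prop : Continuous fun q : X × X × X => (q.1, q.2.1))
  have hdisj : Disjoint (edgeRel G) ((fun q : X × X × X => (q.1, q.2.2)) '' ⋂ b, P b) := by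
    rw [Set.disjoint_left]
    rintro _ huv ⟨⟨u, w, v⟩, hq, rfl⟩
    have h₁ : G.Adj u w := mem_iInter.1 hq true
    have h₂ : G.Adj w v := mem_iInter.1 hq false
    classical
    exact htri {u, w, v} (SimpleGraph.is3Clique_triple_iff.2 ⟨h₁, huv, h₂⟩)
  obtain ⟨C, hC₁, hC₂, hCm⟩ := AnalyticSet.measurablySeparable hG
    (hP.image_of_continuous (by fun_prop : Continuous fun q : X × X × X => (q.1, q.2.2))) hdisj
  refine ⟨C, hCm, fun u v h => hC₁ h, fun u v w huw hwv hC => ?_⟩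
  refine Set.disjoint_left.1 hC₂ ⟨(u, w, v), mem_iInter.2 fun b => ?_, rfl⟩ hC
  cases b
  · exact hwv
  · exact huw

/-! ### The Louveau jump is not reducible to the graph -/

theorem borelHomLE_louveauJump {X : Type*} [MeasurableSpace X] (G : SimpleGraph X) :
    BorelHomLE G (louveauJump G) :=
  ⟨fun x _ => x, measurable_pi_lambda _ fun _ => measurable_id, fun _ _ h => ⟨0, fun _ _ => h⟩⟩

theorem not_borelHomLE_louveauJump {X : Type*} [TopologicalSpace X] [PolishSpace X]
    [MeasurableSpace X] [BorelSpace X] {G : SimpleGraph X} (hG : IsAnalyticGraph G)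
    (htri : G.CliqueFree 3) (hedge : ∃ x y, G.Adj x y) :
    ¬ BorelHomLE (louveauJump G) G := by
  intro hhom
  obtain ⟨a, b, hab⟩ := hedge
  obtain ⟨C, hCm, hC₁, hC₂⟩ := exists_measurableSet_separating hG htri
  have : Nonempty (X × X) := ⟨(a, b)⟩
  obtain ⟨A, hA, hAne⟩ := exists_measurableSet_forall_ne_preimage hCm
  have hlim := hasBorelLimits_atTop hhom
  obtain ⟨F, hF, hFA⟩ := IsClopenLimit.of_measurableSet hlim hA
  have : Countable (TopologicalSpace.Clopens (ℕ → Bool)) :=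
    TopologicalSpace.Clopens.countable_iff_secondCountable.2 inferInstance
  obtain ⟨g, hg⟩ := exists_surjective_nat (TopologicalSpace.Clopens (ℕ → Bool))
  let r := Function.surjInv hg
  have hr : ∀ s, g (r s) = s := Function.surjInv_eq hg
  -- Each clopen set `s` is spread over the row `r s`, so that changing finitely many entries of
  -- that row is harmless; this leaves room for the starting positions in `rowFlip`.
  obtain ⟨Φ, hΦ, hΦG⟩ :=
    hF.bind (K := fun s => atTop.bind fun j => pure (r s, j))
      fun s => hlim.bind fun j => hasBorelLimits_pure G (r s, j)
  have hev : ∀ v w : ℕ × ℕ → X, (∀ᶠ s in F, ∀ᶠ j in atTop, G.Adj (v (r s, j)) (w (r s, j))) →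
      G.Adj (Φ v) (Φ w) := fun v w h => hΦG v w <|
    eventually_bind.2 <| h.mono fun s hs => eventually_bind.2 <| hs.mono fun j hj => hj
  let ofBool : Bool → X := fun t => bif t then a else b
  have hofBool : ∀ s t, s ≠ t → G.Adj (ofBool s) (ofBool t) := by
    rintro (_ | _) (_ | _) h
    exacts [absurd rfl h, hab.symm, hab, absurd rfl h]
  let H : (ℕ × ℕ → Bool) → X := fun x => Φ fun p => ofBool (x p)
  have hH : Measurable H := hΦ.comp (measurable_pi_lambda _ fun p =>
    (measurable_from_top (f := ofBool)).comp (measurable_pi_apply p))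
  obtain ⟨x, n, hcont⟩ := exists_continuous_comp_rowFlip hH
  classical
  -- Row `i` is flipped exactly when `z` lies in the clopen set with number `i`.
  let c : (ℕ → Bool) → ℕ → Bool := fun z i => decide (z ∈ g i)
  have hc : Continuous c := by
    refine continuous_pi fun i => (continuous_bool_rng true).2 ?_
    convert (g i).isClopen using 1
    ext z
    simp [c]
  refine hAne (fun z => (H x, H (rowFlip n (c z) x)))
    (continuous_const.prodMk (hcont.comp hc)) ?_
  ext z
  refine ⟨fun hz => by_contra fun hzA => ?_, fun hz => ?_⟩
  · -- Off `A` the flip is almost everywhere trivial, so the negation of `x` is a common neighbour.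
    refine hC₂ _ _ (H fun p => !x p) (hev _ _ ?_) (hev _ _ ?_) hz
    · exact Eventually.of_forall fun s => Eventually.of_forall fun j => hofBool _ _ (by simp)
    · refine (hFA z).mono fun s hs => Eventually.of_forall fun j => hofBool _ _ ?_
      have hzs : z ∉ s := fun h => hzA (hs.1 h)
      simp [rowFlip, c, hr, hzs]
  · -- On `A` the flip changes almost every entry.
    refine hC₁ _ _ (hev _ _ ?_)
    refine (hFA z).mono fun s hs => ?_
    filter_upwards [eventually_ge_atTop (n (r s))] with j hj
    refine hofBool _ _ ?_
    have hzs : z ∈ s := hs.2 hz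
    simp [rowFlip, c, hr, hzs, hj]

/-! ### Bipartite Borel graphs -/

/-- A 2-colouring of `G` is carried to the Louveau jump by taking limits of colours along a
nonprincipal ultrafilter; no definability of the colouring is claimed. -/
theorem isBipartite_louveauJump {X : Type*} {G : SimpleGraph X} (hG : G.IsBipartite) :
    (louveauJump G).IsBipartite := by
  classical
  obtain ⟨c⟩ := hG
  refine ⟨SimpleGraph.Coloring.mk
    (fun x => if ∀ᶠ i in (hyperfilter ℕ : Filter ℕ), c (x i) = 0 then (0 : Fin 2) else 1) ?_⟩
  rintro x y ⟨n, hn⟩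
  have hne : ∀ᶠ i in (hyperfilter ℕ : Filter ℕ), (c (y i) = 0 ↔ ¬ c (x i) = 0) := by
    refine Nat.hyperfilter_le_atTop ((eventually_ge_atTop n).mono fun i hi => ?_)
    have := c.valid (hn i hi)
    omega
  have key : (∀ᶠ i in (hyperfilter ℕ : Filter ℕ), c (y i) = 0) ↔
      ¬ ∀ᶠ i in (hyperfilter ℕ : Filter ℕ), c (x i) = 0 :=
    (eventually_congr hne).trans Ultrafilter.eventually_not
  by_cases h : ∀ᶠ i in (hyperfilter ℕ : Filter ℕ), c (x i) = 0 <;> simp [key, h]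

theorem isBorelGraph_louveauJump {X : Type*} [MeasurableSpace X] {G : SimpleGraph X}
    (hG : IsBorelGraph G) : IsBorelGraph (louveauJump G) := by
  have : edgeRel (louveauJump G) =
      ⋃ n, ⋂ i, ⋂ (_ : n ≤ i), (fun p : (ℕ → X) × (ℕ → X) => (p.1 i, p.2 i)) ⁻¹' edgeRel G := by
    ext p
    simp [edgeRel, louveauJump]
  rw [IsBorelGraph, this]
  refine .iUnion fun n => .iInter fun i => .iInter fun _ => ?_
  exact (((measurable_pi_apply i).comp measurable_fst).prodMk
    ((measurable_pi_apply i).comp measurable_snd)) hG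

theorem exists_isBorelGraph_isBipartite_not_borelHomLE {X : Type u} [TopologicalSpace X]
    [PolishSpace X] [MeasurableSpace X] [BorelSpace X] {G : SimpleGraph X}
    (hG : IsBorelGraph G) (hbip : G.IsBipartite) :
    ∃ (Y : Type u) (_ : TopologicalSpace Y) (_ : PolishSpace Y) (_ : MeasurableSpace Y)
      (_ : BorelSpace Y) (H : SimpleGraph Y),
      IsBorelGraph H ∧ H.IsBipartite ∧ BorelHomLE G H ∧ ¬ BorelHomLE H G := by
  by_cases hedge : ∃ x y, G.Adj x y
  · exact ⟨ℕ → X, inferInstance, inferInstance, inferInstance, inferInstance, louveauJump G,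
      isBorelGraph_louveauJump hG, isBipartite_louveauJump hbip, borelHomLE_louveauJump G,
      not_borelHomLE_louveauJump hG.analyticSet (hbip.cliqueFree (by norm_num)) hedge⟩
  · -- The jump of an edgeless graph is edgeless; a single edge does instead.
    push Not at hedge
    let : TopologicalSpace (ULift.{u} Bool) := ⊥
    have : DiscreteTopology (ULift.{u} Bool) := ⟨rfl⟩
    let : MeasurableSpace (ULift.{u} Bool) := ⊤
    have : DiscreteMeasurableSpace (ULift.{u} Bool) := ⟨fun _ => trivial⟩
    refine ⟨ULift.{u} Bool, inferInstance, inferInstance, inferInstance, inferInstance, ⊤,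
      .of_discrete, ?_,
      ⟨fun _ => ⟨true⟩, measurable_const, fun x y h => absurd h (hedge x y)⟩, ?_⟩
    · exact (SimpleGraph.Coloring.mk (G := (⊤ : SimpleGraph (ULift.{u} Bool)))
        ULift.down fun {x y} h heq => h (ULift.ext x y heq)).colorable
    · rintro ⟨h, -, hh⟩
      exact hedge _ _ (hh ⟨true⟩ ⟨false⟩ (by simp))

theorem theorem1p1 :
    (∀ (X : Type u) [TopologicalSpace X] [PolishSpace X] [MeasurableSpace X] [BorelSpace X]
        (G : SimpleGraph X),
        IsAnalyticGraph G → (G.IsBipartite ∨ G.CliqueFree 3) → (∃ x y : X, G.Adj x y) →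
        BorelHomLE G (louveauJump G) ∧ ¬ BorelHomLE (louveauJump G) G) ∧
    (∀ (X : Type u) [TopologicalSpace X] [PolishSpace X] [MeasurableSpace X] [BorelSpace X]
        (G : SimpleGraph X),
        IsBorelGraph G → G.IsBipartite →
        ∃ (Y : Type u) (_ : TopologicalSpace Y) (_ : PolishSpace Y) (_ : MeasurableSpace Y)
          (_ : BorelSpace Y) (H : SimpleGraph Y),
          IsBorelGraph H ∧ H.IsBipartite ∧ BorelHomLE G H ∧ ¬ BorelHomLE H G) := by
  refine ⟨fun X _ _ _ _ G hG htri hedge => ⟨borelHomLE_louveauJump G, ?_⟩,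
    fun X _ _ _ _ G hG hbip => exists_isBorelGraph_isBipartite_not_borelHomLE hG hbip⟩
  exact not_borelHomLE_louveauJump hG (htri.elim (fun h => h.cliqueFree (by norm_num)) id) hedge
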